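/- Let $\Gamma$ be a word-hyperbolic group acting isometrically, properly discontinuously and convex cocompactly on a proper $\mathrm{CAT}(-1)$ space $(X,d)$, where convex cocompact means that there is a nonempty $\Gamma$-invariant quasiconvex (for instance, convex) subset of $X$ on which $\Gamma$ acts cocompactly; equivalently, orbit maps $\Gamma\to X$ are quasi-isometric embeddings for the word metric. Let $x_0\in X$, let $g\in\Gamma$, and let $Z(g)=\{h\in\Gamma: hg=gh\}$. Let $\Gamma_0=\{\overline 1,\dots,\overline n\}$ be a finite symmetric generating set of $\Gamma$ with $n$ elements, let $S=\{1,\dots,n\}$, and for a word $w=w_1\cdots w_k$ over $S$ write $\overline w=\overline{w_1}\cdots\overline{w_k}\in\Gamma$; the word $w$ is geodesic if no shorter word represents $\overline w$. Let $(\mathcal G,*,\lambda)$ be a Redfern coding for $Z(g)$, that is: $\mathcal G$ is a finite directed graph with vertex set $V$ and edge set $E\subset V\times V$, $*\in V$ is a vertex at which no edge ends, and $\lambda:E\to S$ is a labelling such that, with $\mathfrak L(\mathcal G)$ the set of finite paths $x=(v_0,v_1,\dots,v_p)$, $p\ge 0$, $v_0=*$, in $\mathcal G$ starting at $*$, and $\lambda(x)=\lambda(v_0,v_1)\cdots\lambda(v_{p-1},v_p)$: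 every $\lambda(x)$ with $x\in\mathfrak L(\mathcal G)$ is a geodesic word; the map $\mathfrak L(\mathcal G)\to Z(g)\backslash\Gamma$, $x\mapsto Z(g)\overline{\lambda(x)}$, is bijective; and every vertex is the endpoint of some path in $\mathfrak L(\mathcal G)$. For $x=(v_0,\dots,v_p)\in\mathfrak L(\mathcal G)$ let $|x|=p+1$ and $L_x=d(\overline{\lambda(x)}\cdot x_0,x_0)$, and for $u\in\mathfrak L(\mathcal G)$ let $\mathcal J(u)$ be the set of $x\in\mathfrak L(\mathcal G)$ with $|x|\ge|u|$ whose first $|u|$ vertices form $u$. Let $\langle y,z\rangle_w=\frac12(d(w,y)+d(w,z)-d(y,z))$ be the Gromov product on $X$, and set \[\tau(u)=d(g\cdot x_0,x_0)-2\left\langle \overline{\lambda(u)}\cdot x_0,\,g\overline{\lambda(u)}\cdot x_0\right\rangle_{g\cdot x_0}-2\left\langle g\cdot x_0,\,\overline{\lambda(u)}\cdot x_0\right\rangle_{x_0}.\] Then $\tau$ is bounded on $\mathfrak L(\mathcal G)$, and there exist constants $K>0$ and $0<\rho<1$ such that for every $l\in\mathbb N$, every $u\in\mathfrak L(\mathcal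 G)$ with $|u|=l$ and every $x\in\mathcal J(u)$, \[\left|d\left(\overline{\lambda(x)}^{-1}g\,\overline{\lambda(x)}\cdot x_0,\,x_0\right)-2L_x-\tau(u)\right|\le K\rho^l.\] -/

import Mathlib

namespace RedfernCoding

open scoped UpperHalfPlane Pointwise

/-! ### Metric geometry -/

/-- The Gromov product `⟨y, z⟩_x` in a metric space. -/
noncomputable def gromovProduct {Y : Type*} [MetricSpace Y] (y z x : Y) : ℝ :=
  (dist x y + dist x z - dist y z) / 2

/-- `γ`, restricted to `[0, dist x y]`, is a geodesic segment from `x` to `y`. -/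
def IsGeodesicSegment {Y : Type*} [MetricSpace Y] (x y : Y) (γ : ℝ → Y) : Prop :=
  γ 0 = x ∧ γ (dist x y) = y ∧
    ∀ s ∈ Set.Icc 0 (dist x y), ∀ t ∈ Set.Icc 0 (dist x y), dist (γ s) (γ t) = |s - t|

/-- Any two points are joined by a geodesic segment. -/
def IsGeodesicSpace (Y : Type*) [MetricSpace Y] : Prop :=
  ∀ x y : Y, ∃ γ : ℝ → Y, IsGeodesicSegment x y γ

/-- A `CAT(-1)` space: a geodesic space whose geodesic triangles are no fatter than their
comparison triangles in the hyperbolic plane `ℍ`. Two points of a triangle either lie on one side,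
where the comparison map is an isometry, or on two sides that share a vertex, here called `x`. -/
def IsCATNegOne (Y : Type*) [MetricSpace Y] : Prop :=
  IsGeodesicSpace Y ∧
    ∀ (x y z : Y) (p q : ℝ → Y), IsGeodesicSegment x y p → IsGeodesicSegment x z q →
      ∃ (x' y' z' : ℍ) (p' q' : ℝ → ℍ),
        dist x' y' = dist x y ∧ dist y' z' = dist y z ∧ dist x' z' = dist x z ∧
        IsGeodesicSegment x' y' p' ∧ IsGeodesicSegment x' z' q' ∧
        ∀ s ∈ Set.Icc 0 (dist x y), ∀ t ∈ Set.Icc 0 (dist x z),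
          dist (p s) (q t) ≤ dist (p' s) (q' t)

/-- A subset is quasiconvex if, for some `R`, every geodesic segment with endpoints in it stays
within distance `R` of it. -/
def IsQuasiconvex {Y : Type*} [MetricSpace Y] (C : Set Y) : Prop :=
  ∃ R : ℝ, ∀ a ∈ C, ∀ b ∈ C, ∀ γ : ℝ → Y, IsGeodesicSegment a b γ →
    ∀ t ∈ Set.Icc 0 (dist a b), ∃ c ∈ C, dist (γ t) c ≤ R

/-- Convex cocompactness, in the coarse form usual for hyperbolic spaces: there is a nonempty
invariant quasiconvex subset on which the group acts cocompactly. A nonempty invariant convex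
subset with compact quotient is a special case (`R = 0`); so is, by stability of quasi-geodesics,
any orbit of an action whose orbit map is a quasi-isometric embedding for the word metric. -/
def IsConvexCocompact (Γ X : Type*) [Group Γ] [MetricSpace X] [MulAction Γ X] : Prop :=
  ∃ C : Set X, C.Nonempty ∧ (∀ h : Γ, h • C = C) ∧ IsQuasiconvex C ∧
    ∃ K : Set X, K ⊆ C ∧ IsCompact K ∧ C ⊆ ⋃ h : Γ, h • K

/-! ### Words and the word metric -/

section Words

variable {Γ : Type*} [Group Γ] {n : ℕ}

/-- `gen` enumerates, without repetition, a finite symmetric set that generates `Γ`. -/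
def IsSymmetricGenerating (gen : Fin n → Γ) : Prop :=
  Function.Injective gen ∧ (∀ i, (gen i)⁻¹ ∈ Set.range gen) ∧
    Subgroup.closure (Set.range gen) = ⊤

/-- The group element represented by a word. -/
def wordEval (gen : Fin n → Γ) (w : List (Fin n)) : Γ := (w.map gen).prod

/-- The word length of a group element. -/
noncomputable def wordLength (gen : Fin n → Γ) (h : Γ) : ℕ :=
  sInf {k | ∃ w : List (Fin n), w.length = k ∧ wordEval gen w = h}

/-- The word metric. -/
noncomputable def wordDist (gen : Fin n → Γ) (a b : Γ) : ℝ := wordLength gen (a⁻¹ * b)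

/-- A word is geodesic if it is a shortest word for the element it represents. -/
def IsGeodesicWord (gen : Fin n → Γ) (w : List (Fin n)) : Prop :=
  w.length = wordLength gen (wordEval gen w)

end Words

/-- `Γ` is word-hyperbolic: for some finite symmetric generating set, the word metric satisfies
Gromov's four-point inequality. -/
def IsWordHyperbolic (Γ : Type*) [Group Γ] : Prop :=
  ∃ (n : ℕ) (gen : Fin n → Γ), IsSymmetricGenerating gen ∧ ∃ δ : ℝ, ∀ a b c d : Γ,
    wordDist gen a b + wordDist gen c d ≤
      max (wordDist gen a c + wordDist gen b d) (wordDist gen a d + wordDist gen b c) + 2 * δ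

/-! ### Labelled graphs and codings -/

/-- A directed graph on `V` with a distinguished vertex at which no edge ends, and with edges
labelled by `Fin n`. -/
structure LabelledGraph (V : Type*) (n : ℕ) where
  edges : Set (V × V)
  star : V
  not_mem_edges_star : ∀ v, (v, star) ∉ edges
  label : edges → Fin n

namespace LabelledGraph

variable {V : Type*} {n : ℕ} (G : LabelledGraph V n)

/-- `x` is the vertex sequence of a path. -/
def IsWalk (x : List V) : Prop := x.IsChain (fun a b => (a, b) ∈ G.edges)

/-- The word read along a path. -/
def labelWord : (x : List V) → G.IsWalk x → List (Fin n)
  | [], _ => []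
  | [_], _ => []
  | _ :: b :: l, h =>
      G.label ⟨_, (List.isChain_cons_cons.1 h).1⟩ ::
        labelWord (b :: l) (List.isChain_cons_cons.1 h).2

/-- The set of paths that start at the distinguished vertex (the one-vertex path included). -/
def Path : Type _ := {x : List V // x.head? = some G.star ∧ G.IsWalk x}

variable {G}

/-- The word `λ(x)` of a path `x`. -/
def Path.word (x : G.Path) : List (Fin n) := G.labelWord x.1 x.2.2

/-- The length `|x|` of a path: its number of vertices. -/
def Path.length (x : G.Path) : ℕ := x.1.length

/-- The set `𝒥(u)` of paths whose first `|u|` vertices form `u`. -/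
def Path.extensions (u : G.Path) : Set G.Path := {x | u.1 <+: x.1}

/-- The group element represented by the word of a path. -/
def Path.elt {Γ : Type*} [Group Γ] (gen : Fin n → Γ) (x : G.Path) : Γ := wordEval gen x.word

variable (G)

/-- `G` is a Redfern coding for the right cosets of `H`: every path from the distinguished vertex
reads a geodesic word, every right coset `H a` is represented by exactly one such path, and every
vertex is reached by such a path. -/
structure IsRedfernCoding {Γ : Type*} [Group Γ] (gen : Fin n → Γ) (H : Subgroup Γ) : Prop where
  geodesic : ∀ x : G.Path, IsGeodesicWord gen x.word
  bijective : Function.Bijective fun x : G.Path =>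
    (Quotient.mk (QuotientGroup.rightRel H) (x.elt gen))
  accessible : ∀ v : V, ∃ x : G.Path, x.1.getLast? = some v

end LabelledGraph

section Displacement

variable {Γ X V : Type*} [Group Γ] [MetricSpace X] [MulAction Γ X] {n : ℕ}
  {G : LabelledGraph V n}

/-- The displacement `L_x` of a path. -/
noncomputable def displacement (gen : Fin n → Γ) (x₀ : X) (x : G.Path) : ℝ :=
  dist (x.elt gen • x₀) x₀

/-- The correction term `τ(u)`. -/
noncomputable def tau (gen : Fin n → Γ) (x₀ : X) (g : Γ) (u : G.Path) : ℝ :=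
  dist (g • x₀) x₀
    - 2 * gromovProduct (u.elt gen • x₀) ((g * u.elt gen) • x₀) (g • x₀)
    - 2 * gromovProduct (g • x₀) (u.elt gen • x₀) x₀

end Displacement

end RedfernCoding

/-!
With the excess of a point `p` defined by `d(p, g p) - 2 d(p, x₀)`, both sides of the estimate are
excesses: `τ(u)` is that of `λ(u) x₀`, and the left-hand quantity is that of `λ(x) x₀`.

Along a path of the coding the points `y_j = w_j x₀`, for the prefixes `w_j` of a word, lie in
different cosets of the centralizer, so the conjugates `w_j⁻¹ g w_j` are pairwise distinct. If the
Gromov product of `y_m` and `g y_m` at `x₀` were large, then `g` would move a long initial part of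
the geodesic `[x₀, y_m]`, hence many of the `y_j`, which follow it by stability of quasi-geodesics,
by a bounded amount. This would give many distinct conjugates of `g` of bounded displacement,
contrary to local finiteness. So these Gromov products are bounded, uniformly over all paths.

The difference of the excesses of `y_{j+1}` and `y_j` is a sum of two cross differences
`d(a, p) - d(a, q) - d(b, p) + d(b, q)` with `d(p, q)` bounded and Gromov product of `a` and `b`
at `p` equal to `d(y_j, x₀)` up to a bounded error. In a `CAT(-1)` space such a cross difference is
exponentially small in this Gromov product, hence in `j`, because orbits are undistorted. Summing
over `j ≥ |u| - 1` gives the estimate.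
-/

namespace RedfernCoding

open scoped UpperHalfPlane Pointwise

/-! ### Geodesic segments and Gromov products -/

section Metric

variable {X : Type*} [MetricSpace X] {x y : X} {γ : ℝ → X}

lemma IsGeodesicSegment.symm (h : IsGeodesicSegment x y γ) :
    IsGeodesicSegment y x fun t => γ (dist x y - t) := by
  refine ⟨by simpa using h.2.1, by simpa [dist_comm y x] using h.1, fun s hs t ht => ?_⟩
  rw [dist_comm y x] at hs ht
  rw [h.2.2 _ ⟨by linarith [hs.2], by linarith [hs.1]⟩ _ ⟨by linarith [ht.2], by linarith [ht.1]⟩,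
    sub_sub_sub_cancel_left, abs_sub_comm]

lemma IsGeodesicSegment.dist_left (h : IsGeodesicSegment x y γ) {s : ℝ}
    (hs : s ∈ Set.Icc 0 (dist x y)) : dist x (γ s) = s := by
  have := h.2.2 0 ⟨le_rfl, dist_nonneg⟩ s hs
  rwa [h.1, zero_sub, abs_neg, abs_of_nonneg hs.1] at this

lemma IsGeodesicSegment.dist_right (h : IsGeodesicSegment x y γ) {s : ℝ}
    (hs : s ∈ Set.Icc 0 (dist x y)) : dist (γ s) y = dist x y - s := by
  have := h.2.2 s hs (dist x y) ⟨dist_nonneg, le_rfl⟩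
  rwa [h.2.1, abs_sub_comm, abs_of_nonneg (sub_nonneg.2 hs.2)] at this

lemma IsGeodesicSegment.continuousOn (h : IsGeodesicSegment x y γ) :
    ContinuousOn γ (Set.Icc 0 (dist x y)) := by
  refine (LipschitzOnWith.of_dist_le_mul (K := 1) fun s hs t ht => ?_).continuousOn
  rw [h.2.2 s hs t ht, Real.dist_eq, NNReal.coe_one, one_mul]

variable (y z x : X)

lemma gromovProduct_comm : gromovProduct y z x = gromovProduct z y x := by
  unfold gromovProduct
  rw [dist_comm y z, add_comm (dist x y)]

lemma gromovProduct_self : gromovProduct y y x = dist x y := by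
  unfold gromovProduct
  rw [dist_self]
  ring

lemma gromovProduct_nonneg : 0 ≤ gromovProduct y z x := by
  have := dist_triangle_left y z x
  unfold gromovProduct
  linarith

lemma gromovProduct_le_dist_left : gromovProduct y z x ≤ dist x y := by
  have := dist_triangle x y z
  unfold gromovProduct
  linarith

lemma gromovProduct_le_dist_right : gromovProduct y z x ≤ dist x z :=
  gromovProduct_comm y z x ▸ gromovProduct_le_dist_left z y x

lemma dist_sub_dist_le_gromovProduct : dist x y - dist y z ≤ gromovProduct y z x := by
  have := dist_triangle_right x y z
  unfold gromovProduct
  linarith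

lemma gromovProduct_add_gromovProduct_swap :
    gromovProduct y z x + gromovProduct y x z = dist x z := by
  unfold gromovProduct
  rw [dist_comm z y, dist_comm z x, dist_comm y x]
  ring

lemma gromovProduct_le_add_dist (x' : X) :
    gromovProduct y z x ≤ gromovProduct y z x' + dist x x' := by
  have h₁ := dist_triangle x x' y
  have h₂ := dist_triangle x x' z
  unfold gromovProduct
  linarith

end Metric

/-! ### The hyperbolic plane -/

section HyperbolicPlane

open Real

/-- The Minkowski form on `ℝ³` in light-cone coordinates: the polar form of the quadratic form
`A * C - B ^ 2` at `(A, B, C)`, which has signature `(1, 2)`. -/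
noncomputable def minkowskiForm : LinearMap.BilinForm ℝ (ℝ × ℝ × ℝ) :=
  LinearMap.mk₂ ℝ (fun u v => (u.1 * v.2.2 + u.2.2 * v.1) / 2 - u.2.1 * v.2.1)
    (fun u u' v => by simp only [Prod.fst_add, Prod.snd_add]; ring)
    (fun c u v => by simp only [Prod.smul_fst, Prod.smul_snd, smul_eq_mul]; ring)
    (fun u v v' => by simp only [Prod.fst_add, Prod.snd_add]; ring)
    (fun c u v => by simp only [Prod.smul_fst, Prod.smul_snd, smul_eq_mul]; ring)

/-- The point of the hyperboloid `minkowskiForm u u = 1` that corresponds to a point of the upper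
half-plane. -/
noncomputable def hyperboloidPoint (z : ℍ) : ℝ × ℝ × ℝ :=
  (1 / z.im, z.re / z.im, (z.re ^ 2 + z.im ^ 2) / z.im)

lemma minkowskiForm_apply (u v : ℝ × ℝ × ℝ) :
    minkowskiForm u v = (u.1 * v.2.2 + u.2.2 * v.1) / 2 - u.2.1 * v.2.1 := rfl

lemma minkowskiForm_hyperboloidPoint (z w : ℍ) :
    minkowskiForm (hyperboloidPoint z) (hyperboloidPoint w) = cosh (dist z w) := by
  have hz := z.im_pos.ne'
  have hw := w.im_pos.ne'
  rw [UpperHalfPlane.cosh_dist', minkowskiForm_apply]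
  simp only [hyperboloidPoint]
  field_simp
  ring

lemma eq_zero_of_minkowskiForm_eq_zero {u v : ℝ × ℝ × ℝ} (hu : 0 < minkowskiForm u u)
    (hv : minkowskiForm v v = 0) (hvu : minkowskiForm v u = 0) : v = 0 := by
  obtain ⟨A, B, C⟩ := u
  obtain ⟨α, β, γ⟩ := v
  simp only [minkowskiForm_apply] at hu hv hvu
  have hA : A ≠ 0 := by
    rintro rfl
    nlinarith [sq_nonneg B]
  have hsq : (A * β - B * α) ^ 2 + (A * C - B ^ 2) * α ^ 2 = 0 := by
    linear_combination 2 * A * α * hvu - A ^ 2 * hv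
  have hα : α = 0 := by
    have : α ^ 2 ≤ 0 := by nlinarith [sq_nonneg (A * β - B * α)]
    simpa using this.antisymm (sq_nonneg α)
  subst hα
  have hβ : β = 0 := by
    have : β ^ 2 = 0 := by linarith
    simpa using this
  subst hβ
  have hγ : γ = 0 := by
    have : A * γ = 0 := by linarith
    exact (mul_eq_zero.1 this).resolve_left hA
  rw [hγ]
  rfl

variable {x y z : ℍ} {p q : ℝ → ℍ} {s t : ℝ}

/-- The difference of the two sides is orthogonal to the points `x`, `y` and `p s` of the
hyperboloid, hence to itself: it is a null vector orthogonal to a vector of positive norm. -/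
lemma sinh_smul_hyperboloidPoint (hp : IsGeodesicSegment x y p) (hs : s ∈ Set.Icc 0 (dist x y)) :
    sinh (dist x y) • hyperboloidPoint (p s) =
      sinh (dist x y - s) • hyperboloidPoint x + sinh s • hyperboloidPoint y := by
  obtain ⟨v, hv⟩ : ∃ v, v = sinh (dist x y - s) • hyperboloidPoint x +
    sinh s • hyperboloidPoint y - sinh (dist x y) • hyperboloidPoint (p s) := ⟨_, rfl⟩
  have form_v (w : ℍ) : minkowskiForm v (hyperboloidPoint w) = sinh (dist x y - s) *
      cosh (dist x w) + sinh s * cosh (dist y w) - sinh (dist x y) * cosh (dist (p s) w) := by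
    simp only [hv, map_sub, map_add, map_smul, LinearMap.sub_apply, LinearMap.add_apply,
      LinearMap.smul_apply, smul_eq_mul, minkowskiForm_hyperboloidPoint]
  have hx := form_v x
  have hy := form_v y
  have hm := form_v (p s)
  rw [dist_self, dist_comm y, dist_comm _ x, hp.dist_left hs, cosh_zero, sinh_sub] at hx
  rw [dist_self, hp.dist_right hs, cosh_zero, sinh_sub, cosh_sub] at hy
  rw [dist_self, dist_comm y, hp.dist_left hs, hp.dist_right hs, cosh_zero, sinh_sub,
    cosh_sub] at hm
  have hcosh := cosh_sq s
  have hx0 : minkowskiForm v (hyperboloidPoint x) = 0 := by rw [hx]; ring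
  have hy0 : minkowskiForm v (hyperboloidPoint y) = 0 := by
    rw [hy]; linear_combination -sinh s * cosh_sq (dist x y)
  have hm0 : minkowskiForm v (hyperboloidPoint (p s)) = 0 := by
    rw [hm]; linear_combination sinh (dist x y) * hcosh
  have hv0 : minkowskiForm v v = 0 := by
    nth_rewrite 2 [hv]
    simp only [map_sub, map_add, map_smul, hx0, hy0, hm0, smul_zero, add_zero, sub_zero]
  have hpos : 0 < minkowskiForm (hyperboloidPoint (p s)) (hyperboloidPoint (p s)) := by
    rw [minkowskiForm_hyperboloidPoint]
    exact cosh_pos _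
  exact (sub_eq_zero.1 (hv.symm.trans (eq_zero_of_minkowskiForm_eq_zero hpos hv0 hm0))).symm

/-- Stewart's theorem of hyperbolic geometry. -/
lemma sinh_mul_cosh_dist (hp : IsGeodesicSegment x y p) (hs : s ∈ Set.Icc 0 (dist x y)) (w : ℍ) :
    sinh (dist x y) * cosh (dist w (p s)) =
      sinh (dist x y - s) * cosh (dist w x) + sinh s * cosh (dist w y) := by
  simpa only [map_add, map_smul, smul_eq_mul, minkowskiForm_hyperboloidPoint] using
    congrArg (minkowskiForm (hyperboloidPoint w)) (sinh_smul_hyperboloidPoint hp hs)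

/-- By the hyperbolic law of cosines, both sides are multiples of the cosine of the angle at `x`. -/
lemma sinh_mul_sinh_mul_cosh_sub_cosh_dist (hp : IsGeodesicSegment x y p)
    (hq : IsGeodesicSegment x z q) (hs : s ∈ Set.Icc 0 (dist x y))
    (ht : t ∈ Set.Icc 0 (dist x z)) :
    sinh (dist x y) * sinh (dist x z) * (cosh s * cosh t - cosh (dist (p s) (q t))) =
      sinh s * sinh t * (cosh (dist x y) * cosh (dist x z) - cosh (dist y z)) := by
  have hps := sinh_mul_cosh_dist hp hs (q t)
  have hqt := sinh_mul_cosh_dist hq ht y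
  rw [dist_comm (q t) x, hq.dist_left ht, dist_comm (q t) y, dist_comm (q t), sinh_sub] at hps
  rw [dist_comm y x, sinh_sub] at hqt
  linear_combination -sinh (dist x z) * hps - sinh s * hqt

lemma sinh_mul_sinh_mul_sinh_half_dist_sq (hp : IsGeodesicSegment x y p)
    (hq : IsGeodesicSegment x z q) (hsy : s ∈ Set.Icc 0 (dist x y))
    (hsz : s ∈ Set.Icc 0 (dist x z)) :
    sinh (dist x y) * sinh (dist x z) * sinh (dist (p s) (q s) / 2) ^ 2 = sinh s ^ 2 *
      (sinh (dist x y - gromovProduct y z x) * sinh (dist x z - gromovProduct y z x)) := by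
  have hangle := sinh_mul_sinh_mul_cosh_sub_cosh_dist hp hq hsy hsz
  have hhalf := cosh_add (dist (p s) (q s) / 2) (dist (p s) (q s) / 2)
  rw [add_halves, ← sq, ← sq, cosh_sq] at hhalf
  set T := gromovProduct y z x with hT
  have hyz : cosh (dist y z) = cosh (dist x y - T + (dist x z - T)) := by
    rw [hT]; unfold gromovProduct; congr 1; ring
  have hsub : cosh (dist x y - dist x z) = cosh (dist x y - T - (dist x z - T)) := by
    congr 1; ring
  rw [cosh_add] at hyz
  rw [cosh_sub, cosh_sub (dist x y - T)] at hsub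
  rw [hhalf, hyz] at hangle
  linear_combination -hangle / 2 - sinh s ^ 2 / 2 * hsub +
    sinh (dist x y) * sinh (dist x z) / 2 * cosh_sq s

lemma sinh_sub_le_exp_neg_mul_sinh (a : ℝ) {T : ℝ} (hT : 0 ≤ T) :
    sinh (a - T) ≤ exp (-T) * sinh a := by
  have h : exp (-T) * exp (-a) ≤ exp T * exp (-a) := by gcongr; linarith
  rw [sinh_eq, sinh_eq, show a - T = -T + a by ring, show -(-T + a) = T + -a by ring, exp_add,
    exp_add]
  linarith

lemma dist_le_exp_sub_gromovProduct (hp : IsGeodesicSegment x y p)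
    (hq : IsGeodesicSegment x z q) (hsy : s ∈ Set.Icc 0 (dist x y))
    (hsz : s ∈ Set.Icc 0 (dist x z)) :
    dist (p s) (q s) ≤ exp (s - gromovProduct y z x) := by
  rcases hsy.1.eq_or_lt with rfl | hs
  · rw [hp.1, hq.1, dist_self]
    exact (exp_pos _).le
  set T := gromovProduct y z x
  have hT : 0 ≤ T := gromovProduct_nonneg y z x
  have hTz : T ≤ dist x z := gromovProduct_le_dist_right y z x
  have hy : 0 < sinh (dist x y) := sinh_pos_iff.2 (hs.trans_le hsy.2)
  have hz : 0 < sinh (dist x z) := sinh_pos_iff.2 (hs.trans_le hsz.2)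
  have hsq : sinh (dist (p s) (q s) / 2) ^ 2 ≤ (exp (-T) * sinh s) ^ 2 := by
    refine le_of_mul_le_mul_left ?_ (mul_pos hy hz)
    calc sinh (dist x y) * sinh (dist x z) * sinh (dist (p s) (q s) / 2) ^ 2
        = sinh s ^ 2 * (sinh (dist x y - T) * sinh (dist x z - T)) :=
          sinh_mul_sinh_mul_sinh_half_dist_sq hp hq hsy hsz
      _ ≤ sinh s ^ 2 * ((exp (-T) * sinh (dist x y)) * (exp (-T) * sinh (dist x z))) := by
          have := sinh_nonneg_iff.2 (sub_nonneg.2 hTz)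
          gcongr <;> exact sinh_sub_le_exp_neg_mul_sinh _ hT
      _ = sinh (dist x y) * sinh (dist x z) * (exp (-T) * sinh s) ^ 2 := by ring
  calc dist (p s) (q s) = 2 * (dist (p s) (q s) / 2) := by ring
    _ ≤ 2 * sinh (dist (p s) (q s) / 2) := by
        gcongr; exact self_le_sinh_iff.2 (by positivity)
    _ ≤ 2 * (exp (-T) * sinh s) := by
        gcongr
        exact le_of_sq_le_sq hsq (mul_pos (exp_pos _) (sinh_pos_iff.2 hs)).le
    _ = exp (-T) * (exp s - exp (-s)) := by rw [sinh_eq]; ring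
    _ ≤ exp (-T) * exp s := by gcongr; linarith [exp_pos (-s)]
    _ = exp (s - T) := by rw [← exp_add]; congr 1; ring

end HyperbolicPlane

/-! ### `CAT(-1)` spaces -/

section CAT

variable {X : Type*} [MetricSpace X]

lemma IsCATNegOne.dist_le_exp_sub_gromovProduct (hX : IsCATNegOne X) {x y z : X} {p q : ℝ → X}
    (hp : IsGeodesicSegment x y p) (hq : IsGeodesicSegment x z q) {s : ℝ}
    (hsy : s ∈ Set.Icc 0 (dist x y)) (hsz : s ∈ Set.Icc 0 (dist x z)) :
    dist (p s) (q s) ≤ Real.exp (s - gromovProduct y z x) := by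
  obtain ⟨x', y', z', p', q', hxy, hyz, hxz, hp', hq', hle⟩ := hX.2 x y z p q hp hq
  have hT : gromovProduct y' z' x' = gromovProduct y z x := by
    unfold gromovProduct
    rw [hxy, hyz, hxz]
  rw [← hT]
  exact (hle s hsy s hsz).trans
    (RedfernCoding.dist_le_exp_sub_gromovProduct hp' hq' (hxy ▸ hsy) (hxz ▸ hsz))

lemma IsCATNegOne.min_gromovProduct_le (hX : IsCATNegOne X) (x y z o : X) :
    min (gromovProduct x y o) (gromovProduct y z o) ≤ gromovProduct x z o + 1 := by
  obtain ⟨p, hp⟩ := hX.1 o x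
  obtain ⟨q, hq⟩ := hX.1 o y
  obtain ⟨r, hr⟩ := hX.1 o z
  set t := min (gromovProduct x y o) (gromovProduct y z o)
  have ht : 0 ≤ t := le_min (gromovProduct_nonneg _ _ _) (gromovProduct_nonneg _ _ _)
  have htxy : t ≤ gromovProduct x y o := min_le_left _ _
  have htyz : t ≤ gromovProduct y z o := min_le_right _ _
  have hx : t ∈ Set.Icc 0 (dist o x) := ⟨ht, htxy.trans (gromovProduct_le_dist_left _ _ _)⟩
  have hy : t ∈ Set.Icc 0 (dist o y) := ⟨ht, htxy.trans (gromovProduct_le_dist_right _ _ _)⟩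
  have hz : t ∈ Set.Icc 0 (dist o z) := ⟨ht, htyz.trans (gromovProduct_le_dist_right _ _ _)⟩
  have hpq : dist (p t) (q t) ≤ 1 := (hX.dist_le_exp_sub_gromovProduct hp hq hx hy).trans
    (Real.exp_le_one_iff.2 (sub_nonpos.2 htxy))
  have hqr : dist (q t) (r t) ≤ 1 := (hX.dist_le_exp_sub_gromovProduct hq hr hy hz).trans
    (Real.exp_le_one_iff.2 (sub_nonpos.2 htyz))
  have hxz := dist_triangle4 x (p t) (r t) z
  rw [dist_comm x (p t), hp.dist_right hx, hr.dist_right hz] at hxz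
  have hpr := dist_triangle (p t) (q t) (r t)
  unfold gromovProduct
  linarith

lemma IsCATNegOne.dist_add_dist_le (hX : IsCATNegOne X) {a p q : X} {γ : ℝ → X} {L s : ℝ}
    (hγ : IsGeodesicSegment p a γ) (hL : dist p q ≤ L) (hLs : L ≤ s) (hs : s ≤ dist p a) :
    dist q (γ s) + dist (γ s) a ≤ dist q a + Real.exp (L - s) := by
  obtain ⟨η, hη⟩ := hX.1 a q
  have hs' : s ∈ Set.Icc 0 (dist p a) := ⟨(dist_nonneg.trans hL).trans hLs, hs⟩
  have hp : dist p a - s ∈ Set.Icc 0 (dist a p) :=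
    ⟨sub_nonneg.2 hs, by rw [dist_comm]; exact sub_le_self _ hs'.1⟩
  have hq : dist p a - s ∈ Set.Icc 0 (dist a q) :=
    ⟨sub_nonneg.2 hs, by linarith [dist_triangle_right p a q]⟩
  have hγη := hX.dist_le_exp_sub_gromovProduct hγ.symm hη hp hq
  rw [sub_sub_cancel] at hγη
  have hexp : dist p a - s - gromovProduct p q a ≤ L - s := by
    linarith [dist_sub_dist_le_gromovProduct p q a, dist_comm p a]
  have htri := dist_triangle_left q (γ s) (η (dist p a - s))
  rw [hη.dist_right hq, dist_comm (η _) (γ s)] at htri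
  rw [hγ.dist_right hs', dist_comm q a]
  linarith [Real.exp_le_exp.2 hexp]

/-- The additive cross ratio of four points; its decay, when the Gromov product of `a` and `b` is
large at `p` and `q` is near `p`, is the source of the exponential estimates. -/
def crossDifference (a b p q : X) : ℝ := dist a p - dist a q - dist b p + dist b q

lemma crossDifference_swap_left (a b p q : X) :
    crossDifference b a p q = -crossDifference a b p q := by
  unfold crossDifference
  ring

lemma crossDifference_swap_right (a b p q : X) :
    crossDifference a b q p = -crossDifference a b p q := by
  unfold crossDifference
  ring

lemma crossDifference_le (a b p q : X) : crossDifference a b p q ≤ 2 * dist p q := by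
  have ha := dist_triangle_right a p q
  have hb := dist_triangle b p q
  unfold crossDifference
  linarith

lemma IsCATNegOne.crossDifference_le (hX : IsCATNegOne X) {a b p q : X} {L : ℝ}
    (hL : dist p q ≤ L) : crossDifference a b p q ≤
      (2 * L + 2) * Real.exp (L - gromovProduct a b p / 2) := by
  have hL0 : 0 ≤ L := dist_nonneg.trans hL
  set s := gromovProduct a b p / 2 with hs
  rcases lt_or_ge s L with hsL | hLs
  · have hexp : 1 ≤ Real.exp (L - s) := Real.one_le_exp (by linarith)
    nlinarith [RedfernCoding.crossDifference_le a b p q]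
  obtain ⟨α, hα⟩ := hX.1 p a
  obtain ⟨β, hβ⟩ := hX.1 p b
  have hsa : s ∈ Set.Icc 0 (dist p a) :=
    ⟨hL0.trans hLs, by linarith [gromovProduct_le_dist_left a b p]⟩
  have hsb : s ∈ Set.Icc 0 (dist p b) :=
    ⟨hL0.trans hLs, by linarith [gromovProduct_le_dist_right a b p]⟩
  have hαβ : dist (α s) (β s) ≤ Real.exp (L - s) :=
    (hX.dist_le_exp_sub_gromovProduct hα hβ hsa hsb).trans (Real.exp_le_exp.2 (by linarith))
  have ha := hX.dist_add_dist_le hα hL hLs hsa.2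
  have hb := dist_triangle q (β s) b
  rw [hα.dist_right hsa] at ha
  rw [hβ.dist_right hsb] at hb
  have hq := dist_triangle_right q (β s) (α s)
  rw [dist_comm (β s)] at hq
  have hLexp : 0 ≤ L * Real.exp (L - s) := by positivity
  unfold crossDifference
  rw [dist_comm a, dist_comm a, dist_comm b, dist_comm b]
  linarith

lemma IsCATNegOne.abs_crossDifference_le (hX : IsCATNegOne X) {a b p q : X} {L : ℝ}
    (hL : dist p q ≤ L) : |crossDifference a b p q| ≤
      (2 * L + 2) * Real.exp (L - gromovProduct a b p / 2) := by
  refine abs_le'.2 ⟨hX.crossDifference_le hL, ?_⟩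
  rw [← crossDifference_swap_left, gromovProduct_comm]
  exact hX.crossDifference_le hL

end CAT

/-! ### Stability of quasi-geodesics -/

section Stability

open Filter Asymptotics in
lemma eventually_exists_add_lt_and_mul_add_le_mul_two_pow {a c : ℝ} (b L : ℝ) (ha : 0 ≤ a)
    (hc : 0 < c) : ∀ᶠ D : ℝ in atTop, ∃ k : ℕ, k + L < D ∧ a * D + b ≤ c * 2 ^ k := by
  have htwo : Tendsto (fun k : ℕ => ‖(2 : ℝ) ^ k‖) atTop atTop := by
    simpa using tendsto_pow_atTop_atTop_of_one_lt (one_lt_two : (1 : ℝ) < 2)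
  have hlinear : (fun k : ℕ => 2 * a * (k : ℝ) + (2 * a + b)) =o[atTop] fun k => (2 : ℝ) ^ k :=
    ((isLittleO_coe_const_pow_of_one_lt one_lt_two).const_mul_left _).add
      (isLittleO_const_left.2 (Or.inr htwo))
  have hfloor : Tendsto (fun D : ℝ => ⌊D / 2⌋₊) atTop atTop :=
    tendsto_nat_floor_atTop.comp (tendsto_id.atTop_div_const two_pos)
  filter_upwards [hfloor.eventually (hlinear.def hc), eventually_gt_atTop (max 0 (2 * L))]
    with D hD hDL
  have hle : (⌊D / 2⌋₊ : ℝ) ≤ D / 2 := Nat.floor_le (by linarith [le_max_left 0 (2 * L)])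
  have hlt := Nat.lt_floor_add_one (D / 2)
  refine ⟨⌊D / 2⌋₊, by linarith [le_max_right 0 (2 * L)], ?_⟩
  rw [Real.norm_eq_abs, Real.norm_of_nonneg (by positivity)] at hD
  nlinarith [le_abs_self (2 * a * (⌊D / 2⌋₊ : ℝ) + (2 * a + b))]

variable {X : Type*} [MetricSpace X]

/-- Bisection costs `1` per halving, so a chain of `2 ^ k` steps loses only `k`. -/
lemma IsCATNegOne.le_gromovProduct_chain (hX : IsCATNegOne X) (f : ℕ → X) (z : X) {r : ℝ}
    {k i j : ℕ} (hij : i < j) (hk : j ≤ i + 2 ^ k)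
    (hf : ∀ l ∈ Set.Ico i j, r ≤ gromovProduct (f l) (f (l + 1)) z) :
    r ≤ gromovProduct (f i) (f j) z + k := by
  induction k generalizing i j with
  | zero =>
    obtain rfl : j = i + 1 := by omega
    simpa using hf i ⟨le_rfl, hij⟩
  | succ k ih =>
    rw [pow_succ] at hk
    push_cast
    rcases le_or_gt j (i + 2 ^ k) with hj | hj
    · linarith [ih hij hj hf]
    · have hleft := ih (j := i + 2 ^ k) (by simp) le_rfl
        fun l hl => hf l ⟨hl.1, hl.2.trans hj⟩
      have hright := ih (i := i + 2 ^ k) hj (by omega)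
        fun l hl => hf l ⟨le_self_add.trans hl.1, hl.2⟩
      have := hX.min_gromovProduct_le (f i) (f (i + 2 ^ k)) (f j) z
      rcases min_le_iff.1 this with h | h <;> linarith

/-- The path `y 0, …, y m`, with steps of length at most `L`, is a quasi-geodesic: indices at
distance `k` have images at distance at least `c * k - b`. -/
structure IsQuasigeodesic (c b L : ℝ) (y : ℕ → X) (m : ℕ) : Prop where
  dist_succ_le : ∀ i < m, dist (y i) (y (i + 1)) ≤ L
  le_dist : ∀ i j, i ≤ j → j ≤ m → c * (j - i : ℕ) ≤ dist (y i) (y j) + b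

/-- A quasi-geodesic far from `z` needs few steps between nearby points, hence cannot spread over
different directions as seen from `z`. -/
lemma IsQuasigeodesic.le_gromovProduct {c b L D R : ℝ} {y : ℕ → X} {m i j k : ℕ} {z : X}
    (hy : IsQuasigeodesic c b L y m) (hX : IsCATNegOne X) (hc : 0 < c) (hL : 0 ≤ L)
    (hi : i ≤ m) (hj : j ≤ m) (hR : dist (y i) (y j) ≤ R) (hk : R + b ≤ c * 2 ^ k)
    (hD : ∀ l ≤ m, D ≤ dist z (y l)) : D - L ≤ gromovProduct (y i) (y j) z + k := by
  wlog hij : i ≤ j generalizing i j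
  · rw [gromovProduct_comm]
    exact this hj hi (dist_comm (y i) (y j) ▸ hR) (le_of_not_ge hij)
  rcases hij.eq_or_lt with rfl | hij'
  · rw [gromovProduct_self]
    linarith [hD i hi, (Nat.cast_nonneg k : (0 : ℝ) ≤ k)]
  refine hX.le_gromovProduct_chain y z hij' ?_ fun l hl => ?_
  · have hsteps : c * (j - i : ℕ) ≤ c * (2 ^ k : ℕ) := by
      push_cast
      linarith [hy.le_dist i j hij hj]
    exact Nat.sub_le_iff_le_add'.1 (Nat.cast_le.1 (le_of_mul_le_mul_left hsteps hc))
  · have hlm : l < m := hl.2.trans_le hj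
    linarith [dist_sub_dist_le_gromovProduct (y l) (y (l + 1)) z, hy.dist_succ_le l hlm,
      hD l hlm.le]

variable {x y : X} {γ : ℝ → X} {A : Set X} {t D : ℝ}

lemma IsGeodesicSegment.exists_le_gromovProduct (hγ : IsGeodesicSegment x y γ) (hx : x ∈ A)
    (ht : t ∈ Set.Icc 0 (dist x y)) (hfar : ∀ p ∈ A, D ≤ dist (γ t) p)
    (hnear : ∀ u ∈ Set.Icc 0 (dist x y), ∃ p ∈ A, dist (γ u) p ≤ D) :
    ∃ u ∈ Set.Icc 0 t, t - 2 * D ≤ u ∧ ∃ p ∈ A,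
      dist (γ u) p ≤ D ∧ D ≤ gromovProduct (γ u) p (γ t) := by
  have hD0 : 0 ≤ D := (hnear t ht).elim fun _ hp => dist_nonneg.trans hp.2
  rcases le_total (2 * D) t with hDt | htD
  · have hu : t - 2 * D ∈ Set.Icc 0 (dist x y) := ⟨by linarith, by linarith [ht.2]⟩
    obtain ⟨p, hpA, hp⟩ := hnear _ hu
    have hut : dist (γ t) (γ (t - 2 * D)) = 2 * D := by
      rw [hγ.2.2 _ ht _ hu, sub_sub_cancel, abs_of_nonneg (by linarith)]
    exact ⟨_, ⟨hu.1, by linarith⟩, le_rfl, p, hpA, hp, by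
      linarith [dist_sub_dist_le_gromovProduct (γ (t - 2 * D)) p (γ t)]⟩
  · refine ⟨0, ⟨le_rfl, ht.1⟩, by linarith, x, hx, ?_, ?_⟩
    · rwa [hγ.1, dist_self]
    · rw [hγ.1, gromovProduct_self]
      exact hfar x hx

lemma IsCATNegOne.exists_min_gromovProduct_le_two (hX : IsCATNegOne X)
    (hγ : IsGeodesicSegment x y γ) (hx : x ∈ A) (hy : y ∈ A) (ht : t ∈ Set.Icc 0 (dist x y))
    (hfar : ∀ p ∈ A, D ≤ dist (γ t) p)
    (hnear : ∀ u ∈ Set.Icc 0 (dist x y), ∃ p ∈ A, dist (γ u) p ≤ D) :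
    ∃ p ∈ A, ∃ q ∈ A, dist p q ≤ 6 * D ∧ min D (gromovProduct p q (γ t)) ≤ 2 := by
  set ℓ := dist x y with hℓ
  have hyx : dist y x = ℓ := dist_comm y x
  obtain ⟨u, hu, hut, p, hpA, hup, hpD⟩ := hγ.exists_le_gromovProduct hx ht hfar hnear
  obtain ⟨v, hv, hvt, q, hqA, hvq, hqD⟩ := hγ.symm.exists_le_gromovProduct (A := A) (t := ℓ - t) hy
    (by rw [hyx]; exact ⟨sub_nonneg.2 ht.2, sub_le_self _ ht.1⟩)
    (by simpa only [← hℓ, sub_sub_cancel] using hfar) fun u hu =>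
      hnear (ℓ - u) ⟨sub_nonneg.2 (hyx ▸ hu.2), sub_le_self _ hu.1⟩
  simp only [← hℓ, sub_sub_cancel] at hvq hqD
  set v' := ℓ - v
  have hu' : u ∈ Set.Icc 0 ℓ := ⟨hu.1, hu.2.trans ht.2⟩
  have hv' : v' ∈ Set.Icc 0 ℓ := ⟨by linarith [hv.2, ht.1], sub_le_self _ hv.1⟩
  have htv : t ≤ v' := by linarith [hv.2]
  have huv : dist (γ u) (γ v') = v' - u := by
    rw [hγ.2.2 _ hu' _ hv', abs_of_nonpos (by linarith [hu.2]), neg_sub]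
  have hzero : gromovProduct (γ u) (γ v') (γ t) = 0 := by
    unfold gromovProduct
    rw [huv, hγ.2.2 _ ht _ hu', hγ.2.2 _ ht _ hv', abs_of_nonneg (sub_nonneg.2 hu.2),
      abs_of_nonpos (sub_nonpos.2 htv)]
    ring
  have hupq := hX.min_gromovProduct_le (γ u) p q (γ t)
  have huqv := hX.min_gromovProduct_le (γ u) q (γ v') (γ t)
  rw [gromovProduct_comm q, hzero] at huqv
  refine ⟨p, hpA, q, hqA, ?_, ?_⟩
  · have := dist_triangle4 p (γ u) (γ v') q
    rw [dist_comm p (γ u), huv] at this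
    linarith
  · rw [min_le_iff] at hupq huqv ⊢
    grind

/-- At the point of the geodesic farthest from the path, at distance `D` say, the path joins the two
sides outside the ball of radius `D` and so has exponentially many steps in `D`, but it joins points
at distance at most `6 * D`. -/
theorem IsCATNegOne.exists_dist_quasigeodesic_le (hX : IsCATNegOne X) {c L : ℝ} (b : ℝ)
    (hc : 0 < c) (hL : 0 ≤ L) : ∃ M : ℝ, ∀ (y : ℕ → X) (m : ℕ), IsQuasigeodesic c b L y m →
      ∀ γ : ℝ → X, IsGeodesicSegment (y 0) (y m) γ → ∀ t ∈ Set.Icc 0 (dist (y 0) (y m)),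
        ∃ i ≤ m, dist (γ t) (y i) ≤ M := by
  obtain ⟨M, hM⟩ := Filter.eventually_atTop.1 <|
    eventually_exists_add_lt_and_mul_add_le_mul_two_pow b (2 + L) (by norm_num : (0 : ℝ) ≤ 6) hc
  refine ⟨M, fun y m hy γ hγ t ht => ?_⟩
  set A : Set X := y '' Set.Iic m
  have hA : IsCompact A := ((Set.finite_Iic m).image y).isCompact
  have hA₀ : y 0 ∈ A := ⟨0, Nat.zero_le _, rfl⟩
  have hAm : y m ∈ A := ⟨m, Set.mem_Iic.2 le_rfl, rfl⟩
  obtain ⟨t₀, ht₀, hmax⟩ := isCompact_Icc.exists_isMaxOn ⟨t, ht⟩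
    ((Metric.continuous_infDist_pt A).comp_continuousOn hγ.continuousOn)
  set D := Metric.infDist (γ t₀) A
  have hfar : ∀ p ∈ A, D ≤ dist (γ t₀) p := fun p hp => Metric.infDist_le_dist_of_mem hp
  have hnear : ∀ u ∈ Set.Icc 0 (dist (y 0) (y m)), ∃ p ∈ A, dist (γ u) p ≤ D := fun u hu => by
    obtain ⟨p, hp, hup⟩ := hA.exists_infDist_eq_dist ⟨_, hA₀⟩ (γ u)
    exact ⟨p, hp, hup ▸ hmax hu⟩
  suffices hDM : D ≤ M by
    obtain ⟨_, ⟨i, hi, rfl⟩, hti⟩ := hnear t ht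
    exact ⟨i, hi, hti.trans hDM⟩
  by_contra! hDM
  obtain ⟨_, ⟨i, hi, rfl⟩, _, ⟨j, hj, rfl⟩, hij, hmin⟩ :=
    hX.exists_min_gromovProduct_le_two hγ hA₀ hAm ht₀ hfar hnear
  obtain ⟨k, hkD, hk⟩ := hM D hDM.le
  have hgp := hy.le_gromovProduct hX hc hL hi hj hij hk fun l hl => hfar _ ⟨l, hl, rfl⟩
  rcases min_le_iff.1 hmin with h | h <;> linarith [(Nat.cast_nonneg k : (0 : ℝ) ≤ k)]

end Stability

/-! ### Words -/

section Words

variable {Γ : Type*} [Group Γ] {n : ℕ} {gen : Fin n → Γ} {w : List (Fin n)}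

lemma wordEval_append (w w' : List (Fin n)) :
    wordEval gen (w ++ w') = wordEval gen w * wordEval gen w' := by
  simp [wordEval]

lemma wordEval_take_succ {i : ℕ} (hi : i < w.length) :
    wordEval gen (w.take (i + 1)) = wordEval gen (w.take i) * gen w[i] := by
  rw [List.take_succ_eq_append_getElem hi, wordEval_append]
  simp [wordEval]

lemma wordLength_wordEval_le (w : List (Fin n)) : wordLength gen (wordEval gen w) ≤ w.length :=
  Nat.sInf_le ⟨w, rfl, rfl⟩

lemma exists_length_eq_wordLength_wordEval (w : List (Fin n)) :
    ∃ v : List (Fin n),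
      v.length = wordLength gen (wordEval gen w) ∧ wordEval gen v = wordEval gen w :=
  Nat.sInf_mem (s := {k | ∃ v : List (Fin n), v.length = k ∧ wordEval gen v = wordEval gen w})
    ⟨_, w, rfl, rfl⟩

lemma IsSymmetricGenerating.wordEval_surjective (hgen : IsSymmetricGenerating gen) :
    Function.Surjective (wordEval gen) := fun h => by
  have hinv : (Set.range gen)⁻¹ ⊆ Set.range gen := by
    rintro a ⟨i, hi⟩
    rw [← inv_inv a, ← hi]
    exact hgen.2.1 i
  have hclosure : Submonoid.closure (Set.range gen) = ⊤ := by
    rw [← Set.union_eq_self_of_subset_right hinv, ← Subgroup.closure_toSubmonoid, hgen.2.2]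
    rfl
  obtain ⟨l, hl, rfl⟩ := Submonoid.exists_list_of_mem_closure (hclosure ▸ Submonoid.mem_top h)
  obtain ⟨w, rfl⟩ : l ∈ Set.range (List.map gen) := by
    rwa [Set.range_list_map]
  exact ⟨w, rfl⟩

lemma IsSymmetricGenerating.exists_length_eq_wordLength (hgen : IsSymmetricGenerating gen) (h : Γ) :
    ∃ w : List (Fin n), w.length = wordLength gen h ∧ wordEval gen w = h := by
  obtain ⟨w, rfl⟩ := hgen.wordEval_surjective h
  exact exists_length_eq_wordLength_wordEval w

lemma IsSymmetricGenerating.wordLength_mul_le (hgen : IsSymmetricGenerating gen) (a b : Γ) :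
    wordLength gen (a * b) ≤ wordLength gen a + wordLength gen b := by
  obtain ⟨v, hv, rfl⟩ := hgen.exists_length_eq_wordLength a
  obtain ⟨w, hw, rfl⟩ := hgen.exists_length_eq_wordLength b
  rw [← hv, ← hw, ← wordEval_append, ← List.length_append]
  exact wordLength_wordEval_le _

lemma IsSymmetricGenerating.wordLength_inv_mul_le_mul (hgen : IsSymmetricGenerating gen)
    {f : ℕ → Γ} {M m : ℕ} (hf : ∀ i < m, wordLength gen ((f i)⁻¹ * f (i + 1)) ≤ M) :
    wordLength gen ((f 0)⁻¹ * f m) ≤ m * M := by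
  induction m with
  | zero => simpa [wordEval] using wordLength_wordEval_le (gen := gen) []
  | succ m ih =>
    calc wordLength gen ((f 0)⁻¹ * f (m + 1))
        = wordLength gen ((f 0)⁻¹ * f m * ((f m)⁻¹ * f (m + 1))) := by group
      _ ≤ m * M + M := (hgen.wordLength_mul_le _ _).trans
          (add_le_add (ih fun i hi => hf i (hi.trans m.lt_succ_self)) (hf m m.lt_succ_self))
      _ = (m + 1) * M := by ring

lemma IsSymmetricGenerating.finite_wordLength_le (hgen : IsSymmetricGenerating gen) (N : ℕ) :
    {h : Γ | wordLength gen h ≤ N}.Finite := by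
  refine ((List.finite_length_le (Fin n) N).image (wordEval gen)).subset fun h hh => ?_
  obtain ⟨w, hw, rfl⟩ := hgen.exists_length_eq_wordLength h
  exact ⟨w, hw.trans_le hh, rfl⟩

lemma IsGeodesicWord.sub_le_wordLength (hw : IsGeodesicWord gen w) {i j : ℕ} (hij : i ≤ j)
    (hj : j ≤ w.length) :
    j - i ≤ wordLength gen ((wordEval gen (w.take i))⁻¹ * wordEval gen (w.take j)) := by
  have hmiddle : wordEval gen (w.take j) =
      wordEval gen (w.take i) * wordEval gen ((w.take j).drop i) := by
    rw [← wordEval_append]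
    congr 1
    conv_lhs => rw [← List.take_append_drop i (w.take j), List.take_take, min_eq_left hij]
  rw [hmiddle, inv_mul_cancel_left]
  obtain ⟨v, hv, hveval⟩ := exists_length_eq_wordLength_wordEval (gen := gen) ((w.take j).drop i)
  have heval : wordEval gen (w.take i ++ v ++ w.drop j) = wordEval gen w := by
    rw [wordEval_append, wordEval_append, hveval, ← hmiddle, ← wordEval_append,
      List.take_append_drop]
  have hlen := wordLength_wordEval_le (gen := gen) (w.take i ++ v ++ w.drop j)
  rw [heval, ← hw, List.length_append, List.length_append, List.length_take, List.length_drop]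
    at hlen
  omega

lemma IsGeodesicWord.take (hw : IsGeodesicWord gen w) (k : ℕ) : IsGeodesicWord gen (w.take k) := by
  refine le_antisymm ?_ (wordLength_wordEval_le _)
  have := hw.sub_le_wordLength (Nat.zero_le _) (min_le_right k w.length)
  rwa [← List.take_eq_take_min, Nat.sub_zero, List.take_zero, show wordEval gen [] = 1 from rfl,
    inv_one, one_mul, ← List.length_take] at this

/-- The prefixes of `w` conjugate `g` to pairwise distinct elements: they lie in distinct right
cosets of the centralizer of `g`. -/
def HasDistinctPrefixConjugates (gen : Fin n → Γ) (g : Γ) (w : List (Fin n)) : Prop :=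
  Set.InjOn (fun i => (wordEval gen (w.take i))⁻¹ * g * wordEval gen (w.take i))
    (Set.Iic w.length)

lemma HasDistinctPrefixConjugates.take {g : Γ} (hw : HasDistinctPrefixConjugates gen g w) (k : ℕ) :
    HasDistinctPrefixConjugates gen g (w.take k) := by
  intro i hi j hj hij
  simp only [Set.mem_Iic, List.length_take, le_min_iff] at hi hj
  simp only [List.take_take, min_eq_left hi.1, min_eq_left hj.1] at hij
  exact hw hi.2 hj.2 hij

end Words

/-! ### Orbits -/

section Orbits

variable {Γ X : Type*} [Group Γ] [MulAction Γ X] {n : ℕ} {gen : Fin n → Γ} {w : List (Fin n)}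
  {x₀ : X}

/-- The points of the orbit of `x₀` reached by the prefixes of the word `w`. -/
def prefixOrbit (gen : Fin n → Γ) (x₀ : X) (w : List (Fin n)) (i : ℕ) : X :=
  wordEval gen (w.take i) • x₀

lemma prefixOrbit_zero : prefixOrbit gen x₀ w 0 = x₀ := one_smul Γ x₀

lemma prefixOrbit_length : prefixOrbit gen x₀ w w.length = wordEval gen w • x₀ := by
  rw [prefixOrbit, List.take_length]

variable [MetricSpace X] {c b : ℝ}

lemma finite_dist_smul_le (Γ : Type*) [Group Γ] [MulAction Γ X] [ProperSpace X]
    [ProperlyDiscontinuousSMul Γ X] (x : X) (Q : ℝ) : {h : Γ | dist (h • x) x ≤ Q}.Finite := by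
  refine (ProperlyDiscontinuousSMul.finite_disjoint_inter_image (Γ := Γ)
    (isCompact_singleton (x := x)) (isCompact_closedBall x Q)).subset fun h hh => ?_
  exact ⟨h • x, ⟨x, rfl, rfl⟩, hh⟩

/-- The orbit map at `x₀` is a quasi-isometric embedding for the word metric. Only the lower bound
with constants `c` and `b` is recorded: the upper bound always holds. -/
def IsUndistortedOrbit (gen : Fin n → Γ) (x₀ : X) (c b : ℝ) : Prop :=
  ∀ h : Γ, c * wordLength gen h ≤ dist (h • x₀) x₀ + b

lemma IsUndistortedOrbit.finite_dist_smul_le (horb : IsUndistortedOrbit gen x₀ c b) (hc : 0 < c)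
    (hgen : IsSymmetricGenerating gen) (Q : ℝ) : {h : Γ | dist (h • x₀) x₀ ≤ Q}.Finite := by
  refine (hgen.finite_wordLength_le ⌊(Q + b) / c⌋₊).subset fun h hh => Nat.le_floor ?_
  rw [le_div_iff₀' hc]
  exact (horb h).trans (add_le_add_left hh b)

variable [IsIsometricSMul Γ X]

lemma dist_smul_smul_eq (a b : Γ) (x y : X) : dist (a • x) (b • y) = dist ((b⁻¹ * a) • x) y := by
  rw [← dist_smul b⁻¹ (a • x) (b • y), inv_smul_smul, mul_smul]

lemma gromovProduct_smul (h : Γ) (y z x : X) :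
    gromovProduct (h • y) (h • z) (h • x) = gromovProduct y z x := by
  simp only [gromovProduct, dist_smul]

lemma IsUndistortedOrbit.change_basepoint {x : X} (horb : IsUndistortedOrbit gen x c b) (y : X) :
    IsUndistortedOrbit gen y c (b + 2 * dist x y) := fun h => by
  have := dist_triangle4 (h • x) (h • y) y x
  rw [dist_smul, dist_comm y x] at this
  linarith [horb h]

lemma IsConvexCocompact.exists_dist_geodesic_orbit_le (hcc : IsConvexCocompact Γ X) :
    ∃ (p : X) (R : ℝ), ∀ (h : Γ) (γ : ℝ → X), IsGeodesicSegment p (h • p) γ →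
      ∀ t ∈ Set.Icc 0 (dist p (h • p)), ∃ a : Γ, dist (γ t) (a • p) ≤ R := by
  obtain ⟨C, ⟨p, hp⟩, hinv, ⟨R, hR⟩, K, -, hK, hCK⟩ := hcc
  obtain ⟨S, hS⟩ := hK.isBounded.subset_closedBall p
  refine ⟨p, R + S, fun h γ hγ t ht => ?_⟩
  have hhp : h • p ∈ C := hinv h ▸ Set.smul_mem_smul_set hp
  obtain ⟨q, hq, hγq⟩ := hR p hp (h • p) hhp γ hγ t ht
  obtain ⟨a, k, hk, rfl⟩ := Set.mem_iUnion.1 (hCK hq)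
  refine ⟨a, (dist_triangle _ (a • k) _).trans (add_le_add hγq ?_)⟩
  rw [dist_smul]
  exact hS hk

lemma IsSymmetricGenerating.wordLength_le_of_geodesic (hgen : IsSymmetricGenerating gen) {p : X}
    {R : ℝ} {M : ℕ} (hM : ∀ a : Γ, dist (a • p) p ≤ 2 * R + 1 → wordLength gen a ≤ M) {h : Γ}
    {γ : ℝ → X} (hγ : IsGeodesicSegment p (h • p) γ)
    (hR : ∀ t ∈ Set.Icc 0 (dist p (h • p)), ∃ a : Γ, dist (γ t) (a • p) ≤ R) :
    wordLength gen h ≤ (⌈dist p (h • p)⌉₊ + 2) * M := by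
  set ℓ := dist p (h • p)
  set N := ⌈ℓ⌉₊
  have hmem (i : ℕ) : min (i : ℝ) ℓ ∈ Set.Icc 0 ℓ :=
    ⟨le_min i.cast_nonneg dist_nonneg, min_le_right _ _⟩
  choose a ha using fun i : ℕ => hR _ (hmem i)
  have hR0 : 0 ≤ R := dist_nonneg.trans (ha 0)
  have hfirst : wordLength gen (a 0) ≤ M := hM _ <| by
    have := ha 0
    rw [Nat.cast_zero, min_eq_left dist_nonneg, hγ.1, dist_comm] at this
    linarith
  have hsteps : ∀ i < N, wordLength gen ((a i)⁻¹ * a (i + 1)) ≤ M := fun i _ => hM _ <| by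
    have hγi : dist (γ (min (i + 1 : ℕ) ℓ)) (γ (min i ℓ)) ≤ 1 := by
      rw [hγ.2.2 _ (hmem _) _ (hmem _)]
      refine (abs_min_sub_min_le_max _ _ _ _).trans ?_
      simp
    have := dist_triangle4 (a (i + 1) • p) (γ (min (i + 1 : ℕ) ℓ)) (γ (min i ℓ)) (a i • p)
    rw [dist_smul_smul_eq, dist_comm (a (i + 1) • p)] at this
    linarith [ha i, ha (i + 1)]
  have hlast : wordLength gen ((a N)⁻¹ * h) ≤ M := hM _ <| by
    have := ha N
    rw [min_eq_right (Nat.le_ceil ℓ), hγ.2.1] at this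
    rw [← dist_smul_smul_eq]
    linarith
  calc wordLength gen h = wordLength gen (a 0 * ((a 0)⁻¹ * a N) * ((a N)⁻¹ * h)) := by group
    _ ≤ M + N * M + M := (hgen.wordLength_mul_le _ _).trans <| add_le_add
        ((hgen.wordLength_mul_le _ _).trans <|
          add_le_add hfirst (hgen.wordLength_inv_mul_le_mul hsteps)) hlast
    _ = (N + 2) * M := by ring

theorem IsConvexCocompact.exists_isUndistortedOrbit [ProperSpace X]
    [ProperlyDiscontinuousSMul Γ X] (hcc : IsConvexCocompact Γ X) (hX : IsGeodesicSpace X)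
    (hgen : IsSymmetricGenerating gen) (x₀ : X) :
    ∃ c b : ℝ, 0 < c ∧ IsUndistortedOrbit gen x₀ c b := by
  obtain ⟨p, R, hR⟩ := hcc.exists_dist_geodesic_orbit_le
  obtain ⟨M, hM⟩ := ((finite_dist_smul_le Γ p (2 * R + 1)).image (wordLength gen)).bddAbove
  suffices IsUndistortedOrbit gen p (1 / (M + 1)) 3 from
    ⟨_, _, by positivity, this.change_basepoint x₀⟩
  intro h
  obtain ⟨γ, hγ⟩ := hX p (h • p)
  have hlen : (wordLength gen h : ℝ) ≤ (⌈dist p (h • p)⌉₊ + 2) * M := by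
    exact_mod_cast hgen.wordLength_le_of_geodesic (fun a ha => hM ⟨a, ha, rfl⟩) hγ (hR h γ hγ)
  have hceil := (Nat.ceil_lt_add_one (dist_nonneg (x := p) (y := h • p))).le
  rw [one_div, inv_mul_le_iff₀ (by positivity), dist_comm (h • p)]
  nlinarith [(M.cast_nonneg : (0 : ℝ) ≤ M), dist_nonneg (x := p) (y := h • p)]

lemma dist_prefixOrbit_succ_le {i : ℕ} (hi : i < w.length) :
    dist (prefixOrbit gen x₀ w i) (prefixOrbit gen x₀ w (i + 1)) ≤
      ∑ j, dist (gen j • x₀) x₀ := by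
  rw [prefixOrbit, prefixOrbit, wordEval_take_succ hi, mul_smul, dist_smul, dist_comm]
  exact Finset.single_le_sum (f := fun j => dist (gen j • x₀) x₀) (fun _ _ => dist_nonneg)
    (Finset.mem_univ _)

lemma IsUndistortedOrbit.isQuasigeodesic (horb : IsUndistortedOrbit gen x₀ c b) (hc : 0 ≤ c)
    (hw : IsGeodesicWord gen w) :
    IsQuasigeodesic c b (∑ j, dist (gen j • x₀) x₀) (prefixOrbit gen x₀ w) w.length where
  dist_succ_le _ := dist_prefixOrbit_succ_le
  le_dist i j hij hj := by
    rw [dist_comm, prefixOrbit, prefixOrbit, dist_smul_smul_eq]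
    refine le_trans ?_ (horb _)
    gcongr
    exact hw.sub_le_wordLength hij hj

end Orbits

/-! ### Displacement along geodesics -/

section Displacement

variable {Γ X : Type*} [Group Γ] [MetricSpace X]

lemma IsGeodesicSegment.gromovProduct_left {x y : X} {γ : ℝ → X} (hγ : IsGeodesicSegment x y γ)
    {s : ℝ} (hs : s ∈ Set.Icc 0 (dist x y)) : gromovProduct y (γ s) x = s := by
  rw [gromovProduct, dist_comm y, hγ.dist_left hs, hγ.dist_right hs]
  ring

lemma IsGeodesicSegment.le_card_mul {x y : X} {γ : ℝ → X} (hγ : IsGeodesicSegment x y γ)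
    {ι : Type*} {S : Finset ι} {p : ι → X} {D T : ℝ} (hT : T ∈ Set.Icc 0 (dist x y))
    (hcover : ∀ s ∈ Set.Icc 0 T, ∃ i ∈ S, dist (γ s) (p i) ≤ D) : T ≤ S.card * (2 * D) := by
  have hD : 0 ≤ D := (hcover 0 ⟨le_rfl, hT.1⟩).elim fun _ hi => dist_nonneg.trans hi.2
  let A (i : ι) : Set ℝ := {s ∈ Set.Icc 0 T | dist (γ s) (p i) ≤ D}
  have hA (i : ι) : MeasureTheory.volume (A i) ≤ ENNReal.ofReal (2 * D) := by
    refine (Real.volume_le_diam _).trans (Metric.ediam_le fun s hs t ht => ?_)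
    rw [edist_dist, Real.dist_eq, ← hγ.2.2 s ⟨hs.1.1, hs.1.2.trans hT.2⟩ t
      ⟨ht.1.1, ht.1.2.trans hT.2⟩]
    exact ENNReal.ofReal_le_ofReal (by linarith [dist_triangle_right (γ s) (γ t) (p i), hs.2, ht.2])
  have hsub : Set.Icc 0 T ⊆ ⋃ i ∈ S, A i := fun s hs => by
    obtain ⟨i, hi, hsi⟩ := hcover s hs
    exact Set.mem_biUnion hi ⟨hs, hsi⟩
  have hvol : ENNReal.ofReal T ≤ ENNReal.ofReal (S.card * (2 * D)) := by
    calc ENNReal.ofReal T = MeasureTheory.volume (Set.Icc 0 T) := by rw [Real.volume_Icc, sub_zero]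
      _ ≤ ∑ i ∈ S, MeasureTheory.volume (A i) :=
        (MeasureTheory.measure_mono hsub).trans (MeasureTheory.measure_biUnion_finset_le S A)
      _ ≤ ∑ _i ∈ S, ENNReal.ofReal (2 * D) := Finset.sum_le_sum fun i _ => hA i
      _ = ENNReal.ofReal (S.card * (2 * D)) := by
        rw [Finset.sum_const, nsmul_eq_mul, ENNReal.ofReal_mul (Nat.cast_nonneg _),
          ENNReal.ofReal_natCast]
  exact (ENNReal.ofReal_le_ofReal_iff (by positivity)).1 hvol

variable [MulAction Γ X] [IsIsometricSMul Γ X]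

lemma dist_conj_smul (g h : Γ) (x : X) :
    dist ((h⁻¹ * g * h) • x) x = dist (g • h • x) (h • x) := by
  rw [mul_assoc, ← dist_smul_smul_eq, mul_smul]

lemma dist_smul_le_add_two_mul_dist (g : Γ) (p q : X) :
    dist (g • q) q ≤ dist (g • p) p + 2 * dist p q := by
  have := dist_triangle4 (g • q) (g • p) p q
  rw [dist_smul, dist_comm q] at this
  linarith

lemma IsCATNegOne.dist_smul_geodesic_le (hX : IsCATNegOne X) (g : Γ) {x y : X} {γ : ℝ → X}
    (hγ : IsGeodesicSegment x y γ) {s : ℝ} (hs : s ∈ Set.Icc 0 (gromovProduct y (g • y) x)) :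
    dist (g • γ s) (γ s) ≤ 3 * dist (g • x) x + 4 := by
  have hsy : s ∈ Set.Icc 0 (dist x y) := ⟨hs.1, hs.2.trans (gromovProduct_le_dist_left _ _ _)⟩
  have hγy := hγ.gromovProduct_left hsy
  have hgγy : s ≤ gromovProduct (g • y) (g • γ s) x + dist (g • x) x := by
    have := gromovProduct_le_add_dist (g • y) (g • γ s) (g • x) x
    rwa [gromovProduct_smul, hγy] at this
  have hγgy : s ≤ gromovProduct (γ s) (g • y) x + 1 := by
    have := hX.min_gromovProduct_le (γ s) y (g • y) x
    rwa [gromovProduct_comm (γ s) y, hγy, min_eq_left hs.2] at this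
  have hγgγ : s - dist (g • x) x ≤ gromovProduct (γ s) (g • γ s) x + 2 := by
    have := hX.min_gromovProduct_le (γ s) (g • y) (g • γ s) x
    have hD : 0 ≤ dist (g • x) x := dist_nonneg
    rcases min_le_iff.1 this with h | h <;> linarith
  have htri := dist_triangle_left x (g • γ s) (g • x)
  rw [dist_smul, hγ.dist_left hsy] at htri
  rw [gromovProduct, hγ.dist_left hsy, dist_comm (γ s)] at hγgγ
  linarith

variable {n : ℕ} {gen : Fin n → Γ} {x₀ : X} {c b : ℝ}

/-- As long as `g` moves the geodesic from `x₀` to `w x₀` a bounded amount, it does so with the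
nearby points of the orbit, and each of these accounts for a conjugate of `g` of bounded
displacement. -/
theorem IsUndistortedOrbit.exists_gromovProduct_smul_le (horb : IsUndistortedOrbit gen x₀ c b)
    (hc : 0 < c) (hgen : IsSymmetricGenerating gen) (hX : IsCATNegOne X) (g : Γ) :
    ∃ B : ℝ, ∀ w : List (Fin n), IsGeodesicWord gen w → HasDistinctPrefixConjugates gen g w →
      gromovProduct (wordEval gen w • x₀) (g • wordEval gen w • x₀) x₀ ≤ B := by
  classical
  obtain ⟨M, hM⟩ := hX.exists_dist_quasigeodesic_le b hc
    (Finset.sum_nonneg fun j _ => dist_nonneg (x := gen j • x₀) (y := x₀))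
  set F := (horb.finite_dist_smul_le hc hgen (3 * dist (g • x₀) x₀ + 4 + 2 * M)).toFinset with hF
  refine ⟨F.card * (2 * M), fun w hw hdistinct => ?_⟩
  set y := prefixOrbit gen x₀ w
  have hy0 : y 0 = x₀ := prefixOrbit_zero
  have hym : y w.length = wordEval gen w • x₀ := prefixOrbit_length
  rw [← hym, ← hy0]
  obtain ⟨γ, hγ⟩ := hX.1 (y 0) (y w.length)
  set T := gromovProduct (y w.length) (g • y w.length) (y 0)
  have hT : T ∈ Set.Icc 0 (dist (y 0) (y w.length)) :=
    ⟨gromovProduct_nonneg _ _ _, gromovProduct_le_dist_left _ _ _⟩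
  let conj (i : ℕ) : Γ := (wordEval gen (w.take i))⁻¹ * g * wordEval gen (w.take i)
  let S : Finset ℕ := {i ∈ Finset.Iic w.length | conj i ∈ F}
  have hcover : ∀ s ∈ Set.Icc 0 T, ∃ i ∈ S, dist (γ s) (y i) ≤ M := fun s hs => by
    obtain ⟨i, hi, hsi⟩ :=
      hM y w.length (horb.isQuasigeodesic hc.le hw) γ hγ s ⟨hs.1, hs.2.trans hT.2⟩
    refine ⟨i, Finset.mem_filter.2 ⟨Finset.mem_Iic.2 hi, ?_⟩, hsi⟩
    rw [hF, Set.Finite.mem_toFinset, Set.mem_ofPred_eq, dist_conj_smul]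
    change dist (g • y i) (y i) ≤ _
    have hmove := hX.dist_smul_geodesic_le g hγ hs
    rw [hy0] at hmove
    linarith [dist_smul_le_add_two_mul_dist g (γ s) (y i)]
  have hcard : S.card ≤ F.card := Finset.card_le_card_of_injOn conj
    (fun i hi => (Finset.mem_filter.1 hi).2) (hdistinct.mono fun i hi => by
      simpa using (Finset.mem_filter.1 hi).1)
  have hM0 : 0 ≤ M := (hcover 0 ⟨le_rfl, hT.1⟩).elim fun _ hi => dist_nonneg.trans hi.2
  exact (hγ.le_card_mul hT hcover).trans (by gcongr)

end Displacement

/-! ### The excess -/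

section Excess

variable {Γ X : Type*} [Group Γ] [MetricSpace X] [MulAction Γ X]

/-- The excess `d(p, g p) - 2 d(p, x₀)` of a point `p`. -/
noncomputable def excess (g : Γ) (x₀ p : X) : ℝ := dist p (g • p) - 2 * dist p x₀

variable [IsIsometricSMul Γ X] {x₀ p q : X} {B L R : ℝ}

lemma abs_excess_le (g : Γ) (hp : gromovProduct p (g • p) x₀ ≤ B) :
    |excess g x₀ p| ≤ dist (g • x₀) x₀ + 2 * B := by
  have hexcess : excess g x₀ p = dist x₀ (g • p) - dist (g • x₀) (g • p) -
      2 * gromovProduct p (g • p) x₀ := by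
    rw [excess, gromovProduct, dist_smul, dist_comm p x₀]
    ring
  have hdist := abs_le.1 (abs_dist_sub_le x₀ (g • x₀) (g • p))
  rw [dist_comm x₀ (g • x₀)] at hdist
  rw [hexcess, abs_le]
  constructor <;> linarith [gromovProduct_nonneg p (g • p) x₀, hdist.1, hdist.2]

lemma excess_sub_excess (g : Γ) (x₀ p q : X) : excess g x₀ p - excess g x₀ q =
    crossDifference (g • p) x₀ p q + crossDifference q (g • x₀) (g • p) (g • q) := by
  simp only [excess, crossDifference, dist_smul, dist_comm (g • p) p, dist_comm (g • p) q,
    dist_comm x₀]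
  ring

lemma IsCATNegOne.abs_excess_sub_excess_le (hX : IsCATNegOne X) (g : Γ) (hpq : dist p q ≤ L)
    (hp : gromovProduct p (g • p) x₀ ≤ B) (hq : gromovProduct q (g • q) x₀ ≤ B)
    (hRp : R ≤ dist x₀ p) (hRq : R ≤ dist x₀ q) :
    |excess g x₀ p - excess g x₀ q| ≤
      (4 * L + 4) * Real.exp (L + (B + dist (g • x₀) x₀ - R) / 2) := by
  have hD : 0 ≤ dist (g • x₀) x₀ := dist_nonneg
  have hL : 0 ≤ 2 * L + 2 := by linarith [dist_nonneg.trans hpq]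
  have hp' : R - B ≤ gromovProduct (g • p) x₀ p := by
    have := gromovProduct_add_gromovProduct_swap (g • p) p x₀
    rw [gromovProduct_comm (g • p) p] at this
    linarith
  have hq' : R - B - dist (g • x₀) x₀ ≤ gromovProduct q (g • x₀) (g • q) := by
    have := gromovProduct_add_gromovProduct_swap q (g • q) (g • x₀)
    rw [dist_smul] at this
    linarith [gromovProduct_le_add_dist q (g • q) (g • x₀) x₀]
  have hleft := hX.abs_crossDifference_le (a := g • p) (b := x₀) hpq
  have hright := hX.abs_crossDifference_le (a := q) (b := g • x₀)
    (show dist (g • q) (g • p) ≤ L by rwa [dist_smul, dist_comm])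
  rw [← abs_neg, ← crossDifference_swap_right] at hright
  calc |excess g x₀ p - excess g x₀ q|
      ≤ |crossDifference (g • p) x₀ p q| + |crossDifference q (g • x₀) (g • p) (g • q)| := by
        rw [excess_sub_excess]
        exact abs_add_le _ _
    _ ≤ (2 * L + 2) * Real.exp (L + (B + dist (g • x₀) x₀ - R) / 2) +
          (2 * L + 2) * Real.exp (L + (B + dist (g • x₀) x₀ - R) / 2) := by
        refine add_le_add (hleft.trans ?_) (hright.trans ?_) <;> gcongr <;> linarith
    _ = (4 * L + 4) * Real.exp (L + (B + dist (g • x₀) x₀ - R) / 2) := by ring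

lemma dist_le_of_dist_succ_le_geometric {Y : Type*} [PseudoMetricSpace Y] {f : ℕ → Y} {C ρ : ℝ}
    {k m : ℕ} (hC : 0 ≤ C) (hρ₀ : 0 ≤ ρ) (hρ₁ : ρ < 1)
    (hf : ∀ i < m, dist (f i) (f (i + 1)) ≤ C * ρ ^ i) (hk : k ≤ m) :
    dist (f k) (f m) ≤ C / (1 - ρ) * ρ ^ k := by
  calc dist (f k) (f m) ≤ ∑ i ∈ Finset.Ico k m, C * ρ ^ i :=
        dist_le_Ico_sum_of_dist_le hk fun _ hi => hf _ hi
    _ = C * ∑ i ∈ Finset.Ico k m, ρ ^ i := by rw [Finset.mul_sum]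
    _ ≤ C * (ρ ^ k / (1 - ρ)) := by gcongr; exact geom_sum_Ico_le_of_lt_one hρ₀ hρ₁
    _ = C / (1 - ρ) * ρ ^ k := by ring

variable {n : ℕ} {gen : Fin n → Γ} {c b : ℝ}

theorem IsUndistortedOrbit.exists_abs_excess_sub_excess_take_le
    (horb : IsUndistortedOrbit gen x₀ c b) (hc : 0 < c) (hgen : IsSymmetricGenerating gen)
    (hX : IsCATNegOne X) (g : Γ) :
    ∃ M K ρ : ℝ, 0 < K ∧ 0 < ρ ∧ ρ < 1 ∧
      ∀ w : List (Fin n), IsGeodesicWord gen w → HasDistinctPrefixConjugates gen g w →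
        |excess g x₀ (wordEval gen w • x₀)| ≤ M ∧
        ∀ k ≤ w.length, |excess g x₀ (wordEval gen w • x₀) -
          excess g x₀ (wordEval gen (w.take k) • x₀)| ≤ K * ρ ^ k := by
  obtain ⟨B, hB⟩ := horb.exists_gromovProduct_smul_le hc hgen hX g
  set L := ∑ j, dist (gen j • x₀) x₀ with hL_def
  set ρ := Real.exp (-c / 2) with hρ
  have hρ₁ : ρ < 1 := Real.exp_lt_one_iff.2 (by linarith)
  set C := (4 * L + 4) * Real.exp (L + (B + dist (g • x₀) x₀ + b) / 2) with hC
  have hC₀ : 0 < C := by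
    have : 0 ≤ L := Finset.sum_nonneg fun _ _ => dist_nonneg
    positivity
  refine ⟨dist (g • x₀) x₀ + 2 * B, C / (1 - ρ), ρ, div_pos hC₀ (sub_pos.2 hρ₁),
    Real.exp_pos _, hρ₁, fun w hw hdistinct =>
      ⟨abs_excess_le g (hB w hw hdistinct), fun k hk => ?_⟩⟩
  set y := prefixOrbit gen x₀ w
  have hy := horb.isQuasigeodesic hc.le hw
  have hyB (i : ℕ) : gromovProduct (y i) (g • y i) x₀ ≤ B := hB _ (hw.take i) (hdistinct.take i)
  have hfar : ∀ i ≤ w.length, c * i - b ≤ dist x₀ (y i) := fun i hi => by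
    have := hy.le_dist 0 i (Nat.zero_le i) hi
    rw [prefixOrbit_zero, Nat.sub_zero] at this
    linarith
  have hstep : ∀ i < w.length,
      dist (excess g x₀ (y i)) (excess g x₀ (y (i + 1))) ≤ C * ρ ^ i := fun i hi => by
    have hfar' := hfar (i + 1) hi
    push_cast at hfar'
    refine (hX.abs_excess_sub_excess_le g (hy.dist_succ_le i hi) (hyB i) (hyB (i + 1))
      (hfar i hi.le) (by linarith)).trans_eq ?_
    rw [← hL_def, hC, hρ, ← Real.exp_nat_mul, mul_assoc, ← Real.exp_add]
    ring_nf
  have hsum := dist_le_of_dist_succ_le_geometric hC₀.le (Real.exp_nonneg _) hρ₁ hstep hk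
  rwa [dist_comm, Real.dist_eq, show y w.length = _ from prefixOrbit_length] at hsum

end Excess

/-! ### Paths of a coding -/

namespace LabelledGraph

variable {V : Type*} {n : ℕ} {G : LabelledGraph V n}

lemma labelWord_take : ∀ (x : List V) (h : G.IsWalk x) (k : ℕ) (h' : G.IsWalk (x.take (k + 1))),
    G.labelWord (x.take (k + 1)) h' = (G.labelWord x h).take k
  | [], _, _, _ => by simp [labelWord]
  | [_], _, _, _ => by simp [labelWord]
  | _ :: _ :: _, _, 0, _ => by simp [labelWord]
  | a :: b :: l, h, k + 1, h' => by
    have ih := labelWord_take (b :: l) (List.isChain_cons_cons.1 h).2 k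
      (List.isChain_cons_cons.1 h').2
    simp only [List.take_succ_cons] at ih ⊢
    simp [labelWord, ih]

lemma length_labelWord : ∀ (x : List V) (h : G.IsWalk x), (G.labelWord x h).length = x.length - 1
  | [], _ => rfl
  | [_], _ => rfl
  | _ :: b :: l, h => by
    simp [labelWord, length_labelWord (b :: l) (List.isChain_cons_cons.1 h).2]

namespace Path

lemma length_word_add_one (x : G.Path) : x.word.length + 1 = x.length := by
  have hne : x.1 ≠ [] := fun h => by simpa [h] using x.2.1
  rw [word, length_labelWord]
  exact Nat.sub_add_cancel (List.length_pos_iff.2 hne)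

/-- The path formed by the first `k + 1` vertices of a path, that is by its first `k` edges; it is
the whole path if there are fewer. -/
def initial (x : G.Path) (k : ℕ) : G.Path :=
  ⟨x.1.take (k + 1), by rw [List.head?_take, if_neg k.succ_ne_zero, x.2.1], x.2.2.take (k + 1)⟩

lemma word_initial (x : G.Path) (k : ℕ) : (x.initial k).word = x.word.take k :=
  labelWord_take x.1 x.2.2 k _

lemma eq_initial_of_mem_extensions {u x : G.Path} (h : x ∈ u.extensions) :
    u = x.initial u.word.length := by
  refine Subtype.ext ?_
  change u.1 = x.1.take (u.word.length + 1)
  rw [length_word_add_one]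
  exact List.prefix_iff_eq_take.1 h

variable {Γ : Type*} [Group Γ] {gen : Fin n → Γ} {g : Γ}

lemma hasDistinctPrefixConjugates_word (hinj : Function.Injective fun x : G.Path =>
      Quotient.mk (QuotientGroup.rightRel (Subgroup.centralizer {g})) (x.elt gen)) (x : G.Path) :
    HasDistinctPrefixConjugates gen g x.word := by
  intro i hi j hj hij
  have hpath : x.initial i = x.initial j := by
    refine hinj (Quotient.sound ?_)
    change QuotientGroup.rightRel _ _ _
    rw [QuotientGroup.rightRel_apply, Subgroup.mem_centralizer_singleton_iff, elt, elt,
      word_initial, word_initial]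
    set a := wordEval gen (x.word.take i)
    set b := wordEval gen (x.word.take j)
    have hconj : a⁻¹ * g * a = b⁻¹ * g * b := hij
    calc b * a⁻¹ * g = b * (a⁻¹ * g * a) * a⁻¹ := by group
      _ = b * (b⁻¹ * g * b) * a⁻¹ := by rw [hconj]
      _ = g * (b * a⁻¹) := by group
  have hlen := congrArg (fun y => y.word.length) hpath
  simpa only [word_initial, List.length_take, min_eq_left (Set.mem_Iic.1 hi),
    min_eq_left (Set.mem_Iic.1 hj)] using hlen

end Path

end LabelledGraph

section Tau

variable {Γ X V : Type*} [Group Γ] [MetricSpace X] [MulAction Γ X] [IsIsometricSMul Γ X] {n : ℕ}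
  {G : LabelledGraph V n} (gen : Fin n → Γ) (x₀ : X) (g : Γ)

lemma tau_eq_excess (u : G.Path) : tau gen x₀ g u = excess g x₀ (u.elt gen • x₀) := by
  unfold tau gromovProduct excess
  rw [mul_smul, dist_smul, dist_comm x₀ (g • x₀), dist_comm x₀ (u.elt gen • x₀)]
  ring

lemma dist_conj_sub_two_mul_displacement (x : G.Path) :
    dist (((x.elt gen)⁻¹ * g * x.elt gen) • x₀) x₀ - 2 * displacement gen x₀ x =
      excess g x₀ (x.elt gen • x₀) := by
  rw [dist_conj_smul, dist_comm (g • _), displacement, excess]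

end Tau

end RedfernCoding

open RedfernCoding in
theorem mainTheorem3_general {Γ X V : Type*} [Group Γ] [MetricSpace X] [MulAction Γ X]
    [IsIsometricSMul Γ X] (hX : IsCATNegOne X) {n : ℕ} (gen : Fin n → Γ)
    (hgen : IsSymmetricGenerating gen) (g : Γ) (G : LabelledGraph V n)
    (hgeod : ∀ x : G.Path, IsGeodesicWord gen x.word)
    (hinj : Function.Injective fun x : G.Path =>
      Quotient.mk (QuotientGroup.rightRel (Subgroup.centralizer {g})) (x.elt gen))
    (x₀ : X) {c b : ℝ} (hc : 0 < c) (horb : IsUndistortedOrbit gen x₀ c b) :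
    ∃ K ρ : ℝ, 0 < K ∧ 0 < ρ ∧ ρ < 1 ∧
      (∃ M : ℝ, ∀ u : G.Path, |tau gen x₀ g u| ≤ M) ∧
      ∀ (l : ℕ) (u : G.Path), u.length = l → ∀ x ∈ u.extensions,
        |dist (((x.elt gen)⁻¹ * g * x.elt gen) • x₀) x₀
            - 2 * displacement gen x₀ x - tau gen x₀ g u| ≤ K * ρ ^ l := by
  obtain ⟨M, K, ρ, hK, hρ₀, hρ₁, hexcess⟩ :=
    horb.exists_abs_excess_sub_excess_take_le hc hgen hX g
  have hpath (x : G.Path) := hexcess x.word (hgeod x) (x.hasDistinctPrefixConjugates_word hinj)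
  refine ⟨K / ρ, ρ, by positivity, hρ₀, hρ₁,
    ⟨M, fun u => tau_eq_excess gen x₀ g u ▸ (hpath u).1⟩, ?_⟩
  rintro _ u rfl x hx
  have hu : u.word = x.word.take u.word.length := by
    rw [← x.word_initial, ← LabelledGraph.Path.eq_initial_of_mem_extensions hx]
  have hle : u.word.length ≤ x.word.length := by
    rw [hu, List.length_take]
    exact min_le_right _ _
  have hρ : K / ρ * ρ ^ u.length = K * ρ ^ u.word.length := by
    rw [← u.length_word_add_one, pow_succ]
    field_simp
  rw [dist_conj_sub_two_mul_displacement, tau_eq_excess, hρ, LabelledGraph.Path.elt,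
    LabelledGraph.Path.elt]
  simpa only [← hu] using (hpath x).2 _ hle

theorem mainTheorem3 {Γ X V : Type*} [Group Γ] [MetricSpace X] [ProperSpace X] [MulAction Γ X]
    [IsIsometricSMul Γ X] [ProperlyDiscontinuousSMul Γ X] [Finite V]
    (hX : RedfernCoding.IsCATNegOne X) (hΓ : RedfernCoding.IsWordHyperbolic Γ)
    (hcc : RedfernCoding.IsConvexCocompact Γ X)
    {n : ℕ} (gen : Fin n → Γ) (hgen : RedfernCoding.IsSymmetricGenerating gen)
    (g : Γ) (G : RedfernCoding.LabelledGraph V n)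
    (hG : G.IsRedfernCoding gen (Subgroup.centralizer {g})) (x₀ : X) :
    ∃ K ρ : ℝ, 0 < K ∧ 0 < ρ ∧ ρ < 1 ∧
      (∃ M : ℝ, ∀ u : G.Path, |RedfernCoding.tau gen x₀ g u| ≤ M) ∧
      ∀ (l : ℕ) (u : G.Path), u.length = l → ∀ x ∈ u.extensions,
        |dist (((x.elt gen)⁻¹ * g * x.elt gen) • x₀) x₀
            - 2 * RedfernCoding.displacement gen x₀ x - RedfernCoding.tau gen x₀ g u| ≤ K * ρ ^ l := by
  obtain ⟨c, b, hc, horb⟩ := hcc.exists_isUndistortedOrbit hX.1 hgen x₀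
  exact mainTheorem3_general hX gen hgen g G hG.geodesic hG.bijective.1 x₀ hc horb
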